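/- Let $A\in\mathbb R^{n\times n}$, $B\in\mathbb R^{n\times s}$, $C\in\mathbb R^{p\times n}$, $Z\in\mathbb R^{n\times q}$, and let $\mathcal V_m\in\mathbb R^{n\times d}$ have orthonormal columns (for instance, an orthonormal basis of a Krylov subspace). Put $$\mathcal T_m=\mathcal V_m^TA\mathcal V_m,\quad B_m=\mathcal V_m^TB,\quad C_m=C\mathcal V_m,\quad Z_m=\mathcal V_m^TZ .$$ A real square matrix is called stable if all its complex eigenvalues have negative real part. Assume that $(\mathcal T_m,B_m)$ is stabilizable ($\mathcal T_m-B_mK$ is stable for some real $K$) and that $(C_m,\mathcal T_m)$ is detectable ($\mathcal T_m-LC_m$ is stable for some real $L$). Then the reduced differential Riccati equation $$\dot Y_m(t)=\mathcal T_m^TY_m(t)+Y_m(t)\mathcal T_m-Y_m(t)B_mB_m^TY_m(t)+C_m^TC_m,\qquad Y_m(0)=Z_mZ_m^T,$$ has a unique solution $Y_m$ on $[0,\infty)$, and the limit $Y_m^\infty=\lim_{t\to\infty}Y_m(t)$ exists. Moreover: 1. $Y_m^\infty$ is the unique symmetric nonnegative definite solution of the reduced algebraic Riccati equation $$0=\mathcal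 T_m^TY+Y\mathcal T_m-YB_mB_m^TY+C_m^TC_m .$$ 2. $Y_m^\infty$ is the only stabilizing solution of that equation, i.e. the only real solution $Y$, symmetric or not, for which $\mathcal T_m-B_mB_m^TY$ is stable. 3. If $(C_m,\mathcal T_m)$ is observable, i.e. the observability matrix with block rows $C_m,\,C_m\mathcal T_m,\dots,C_m\mathcal T_m^{d-1}$ has rank $d$, then $Y_m^\infty$ is positive definite. -/

import Mathlib

open Matrix Filter Topology

/-- The matrix of the projected state operator, `𝒯 = 𝒱ᵀ A 𝒱`. -/
def reducedState {n d : ℕ} (V : Matrix (Fin n) (Fin d) ℝ) (A : Matrix (Fin n) (Fin n) ℝ) :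
    Matrix (Fin d) (Fin d) ℝ :=
  Vᵀ * A * V

/-- The projected input matrix `𝒱ᵀ B`; also used for the factor `Z` of the initial value. -/
def reducedInput {n d s : ℕ} (V : Matrix (Fin n) (Fin d) ℝ) (B : Matrix (Fin n) (Fin s) ℝ) :
    Matrix (Fin d) (Fin s) ℝ :=
  Vᵀ * B

/-- The restricted output matrix `C 𝒱`. -/
def reducedOutput {n d p : ℕ} (V : Matrix (Fin n) (Fin d) ℝ) (C : Matrix (Fin p) (Fin n) ℝ) :
    Matrix (Fin p) (Fin d) ℝ :=
  C * V

/-- A real square matrix is stable (Hurwitz) if all its complex eigenvalues lie in the open left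
half plane. -/
def IsStableMatrix {d : ℕ} (M : Matrix (Fin d) (Fin d) ℝ) : Prop :=
  ∀ μ : ℂ, Module.End.HasEigenvalue (Matrix.toLin' (M.map (algebraMap ℝ ℂ))) μ → μ.re < 0

/-- `(T, B)` is stabilizable: some state feedback `K` makes `T - B K` stable. -/
def IsStabilizable {d s : ℕ} (T : Matrix (Fin d) (Fin d) ℝ) (B : Matrix (Fin d) (Fin s) ℝ) :
    Prop :=
  ∃ K : Matrix (Fin s) (Fin d) ℝ, IsStableMatrix (T - B * K)

/-- `(C, T)` is detectable: some output injection `L` makes `T - L C` stable. -/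
def IsDetectable {d p : ℕ} (C : Matrix (Fin p) (Fin d) ℝ) (T : Matrix (Fin d) (Fin d) ℝ) :
    Prop :=
  ∃ L : Matrix (Fin d) (Fin p) ℝ, IsStableMatrix (T - L * C)

/-- The observability matrix of `(C, T)`, with block rows `C, C T, …, C T ^ (d - 1)`. -/
def observabilityMatrix {d p : ℕ} (C : Matrix (Fin p) (Fin d) ℝ)
    (T : Matrix (Fin d) (Fin d) ℝ) : Matrix (Fin d × Fin p) (Fin d) ℝ :=
  Matrix.of fun ki j => (C * T ^ (ki.1 : ℕ)) ki.2 j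

/-- `(C, T)` is observable: its observability matrix has full column rank. -/
def IsObservable {d p : ℕ} (C : Matrix (Fin p) (Fin d) ℝ) (T : Matrix (Fin d) (Fin d) ℝ) :
    Prop :=
  (observabilityMatrix C T).rank = d

/-- The Riccati operator `Y ↦ Tᵀ Y + Y T - Y B Bᵀ Y + Cᵀ C`. -/
def riccatiOperator {d s p : ℕ} (T : Matrix (Fin d) (Fin d) ℝ) (B : Matrix (Fin d) (Fin s) ℝ)
    (C : Matrix (Fin p) (Fin d) ℝ) (Y : Matrix (Fin d) (Fin d) ℝ) : Matrix (Fin d) (Fin d) ℝ :=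
  Tᵀ * Y + Y * T - Y * B * Bᵀ * Y + Cᵀ * C

/-- `Y` solves the differential Riccati equation on `[0, ∞)` with `Y 0 = Z Zᵀ`. The derivative is
taken entrywise, and is one-sided at `0`; the values of `Y` at negative times play no role. -/
def IsDRESolution {d s p q : ℕ} (T : Matrix (Fin d) (Fin d) ℝ) (B : Matrix (Fin d) (Fin s) ℝ)
    (C : Matrix (Fin p) (Fin d) ℝ) (Z : Matrix (Fin d) (Fin q) ℝ)
    (Y : ℝ → Matrix (Fin d) (Fin d) ℝ) : Prop :=
  Y 0 = Z * Zᵀ ∧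
    ∀ t : ℝ, 0 ≤ t → ∀ i j : Fin d,
      HasDerivWithinAt (fun τ => Y τ i j) (riccatiOperator T B C (Y t) i j) (Set.Ici 0) t

/-- `Y` solves the algebraic Riccati equation. -/
def IsARESolution {d s p : ℕ} (T : Matrix (Fin d) (Fin d) ℝ) (B : Matrix (Fin d) (Fin s) ℝ)
    (C : Matrix (Fin p) (Fin d) ℝ) (Y : Matrix (Fin d) (Fin d) ℝ) : Prop :=
  0 = riccatiOperator T B C Y

/-- `Y` is a stabilizing solution of the algebraic Riccati equation: it is a solution and the
closed-loop matrix `T - B Bᵀ Y` is stable. No symmetry of `Y` is required. -/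
def IsStabilizingARESolution {d s p : ℕ} (T : Matrix (Fin d) (Fin d) ℝ)
    (B : Matrix (Fin d) (Fin s) ℝ) (C : Matrix (Fin p) (Fin d) ℝ)
    (Y : Matrix (Fin d) (Fin d) ℝ) : Prop :=
  IsARESolution T B C Y ∧ IsStableMatrix (T - B * Bᵀ * Y)

/-! The basic tool is the Sylvester map X ↦ A X + X B with A and B stable. It is injective, because
exp(tA) X exp(tB) is constant for X in the kernel and yet tends to zero; in finite dimension it is
then bijective.

Algebraic equation: Newton–Kleinman iteration from a stabilizing gain gives a decreasing sequence of
semidefinite matrices, whose limit P is a solution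
(`IsStabilizable.exists_posSemidef_isARESolution`). Detectability makes every semidefinite solution
stabilizing (`IsDetectable.isStableMatrix_closedLoop`). The difference between P and any stabilizing
solution solves a homogeneous Sylvester equation, so it vanishes.

Differential equation: put A = T - B Bᵀ P and D = Z Zᵀ - P. The Riccati flow is Υ Ξ⁻¹ for the linear
Hamiltonian system started at (1, P + D), explicitly P + exp(tAᵀ) D (1 + W(t) D)⁻¹ exp(tA), with
W(t) the Gramian on [0, t]. Global existence amounts to invertibility of 1 + W(t) D for t ≥ 0, and
convergence to P follows from invertibility of the limit 1 + W D. Both come from the monotonicity of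
vᵀ Ξᵀ Υ v; at the limit, detectability is used once more. -/

section
open scoped Matrix.Norms.Operator
open NormedSpace (exp)

variable {d s p : ℕ}

/-! ### Spectral stability and decay of the matrix exponential. -/

lemma Complex.tendsto_exp_mul_mul_pow {μ : ℂ} (hμ : μ.re < 0) (j : ℕ) :
    Tendsto (fun t : ℝ => Complex.exp (t * μ) * (t : ℂ) ^ j) atTop (𝓝 0) := by
  rw [tendsto_zero_iff_norm_tendsto_zero]
  have h := tendsto_rpow_mul_exp_neg_mul_atTop_nhds_zero j (-μ.re) (by linarith)
  refine h.congr' ?_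
  filter_upwards [eventually_ge_atTop 0] with t ht
  rw [norm_mul, norm_pow, Complex.norm_exp, Complex.norm_real, Real.norm_of_nonneg ht,
    Real.rpow_natCast]
  simp [mul_comm]

/-- On a generalized eigenvector, M is μ plus a commuting part that is nilpotent there, so the
exponential series of that part terminates. -/
lemma Matrix.exp_smul_mulVec_eq_sum {M : Matrix (Fin d) (Fin d) ℂ} {μ : ℂ} {k : ℕ}
    {v : Fin d → ℂ} (hv : (M - μ • 1) ^ k *ᵥ v = 0) (t : ℂ) :
    exp (t • M) *ᵥ v = ∑ j ∈ Finset.range k,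
      (Complex.exp (t * μ) * t ^ j) • ((j.factorial : ℂ)⁻¹ • ((M - μ • 1) ^ j *ᵥ v)) := by
  set N := M - μ • 1 with hN
  have hM : t • M = algebraMap ℂ (Matrix (Fin d) (Fin d) ℂ) (t * μ) + t • N := by
    rw [hN, Algebra.algebraMap_eq_smul_one, smul_sub, smul_smul]; abel
  have hexp : exp (t • M) = Complex.exp (t * μ) • exp (t • N) := by
    have h : exp (algebraMap ℂ (Matrix (Fin d) (Fin d) ℂ) (t * μ)) =
        algebraMap ℂ (Matrix (Fin d) (Fin d) ℂ) (exp (t * μ)) :=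
      (NormedSpace.algebraMap_exp_comm (𝔸 := Matrix (Fin d) (Fin d) ℂ) (t * μ)).symm
    rw [hM, Matrix.exp_add_of_commute _ _ (Algebra.commute_algebraMap_left _ _), h,
      ← Complex.exp_eq_exp_ℂ, Algebra.algebraMap_eq_smul_one, smul_mul_assoc, one_mul]
  have hsum : HasSum (fun j : ℕ => ((j.factorial : ℂ)⁻¹ • (t • N) ^ j) *ᵥ v)
      (exp (t • N) *ᵥ v) := by
    have h := NormedSpace.exp_series_hasSum_exp' (𝕂 := ℂ) (t • N)
    exact h.map ((Matrix.mulVecBilin ℂ ℂ).flip v : _ →ₗ[ℂ] _)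
      (LinearMap.continuous_of_finiteDimensional _)
  have hz : ∀ j ∉ Finset.range k, ((j.factorial : ℂ)⁻¹ • (t • N) ^ j) *ᵥ v = 0 := by
    intro j hj
    obtain ⟨i, rfl⟩ := Nat.exists_eq_add_of_le (not_lt.1 (Finset.mem_range.not.1 hj))
    rw [smul_pow, add_comm, pow_add N, smul_mulVec, smul_mulVec, ← mulVec_mulVec, hv]
    simp
  rw [hexp, smul_mulVec, hsum.unique (hasSum_sum_of_ne_finset_zero hz), Finset.smul_sum]
  refine Finset.sum_congr rfl fun j _ => ?_
  simp only [smul_pow, smul_mulVec, smul_smul]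
  congr 1; ring

/-- Over ℂ the generalized eigenspaces span, and on each of them the flow is a finite sum of terms
exp(tμ) tʲ with Re μ < 0. -/
lemma Matrix.tendsto_exp_smul_mulVec {M : Matrix (Fin d) (Fin d) ℂ}
    (hM : ∀ μ : ℂ, Module.End.HasEigenvalue (Matrix.toLin' M) μ → μ.re < 0) (v : Fin d → ℂ) :
    Tendsto (fun t : ℝ => exp ((t : ℂ) • M) *ᵥ v) atTop (𝓝 0) := by
  have hv : v ∈ ⨆ μ, Module.End.maxGenEigenspace (Matrix.toLin' M) μ := by
    rw [Module.End.iSup_maxGenEigenspace_eq_top]; trivial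
  induction hv using Submodule.iSup_induction' with
  | zero => simp
  | add x y _ _ hx hy => simpa [mulVec_add] using hx.add hy
  | mem μ x hx =>
    by_cases hx0 : x = 0
    · simp [hx0]
    obtain ⟨k, hk⟩ := (Module.End.mem_maxGenEigenspace _ _ _).1 hx
    have hμ : Module.End.HasEigenvalue (Matrix.toLin' M) μ := by
      refine Module.End.hasEigenvalue_of_hasGenEigenvalue (k := k) ?_
      rw [Module.End.HasGenEigenvalue, Module.End.HasUnifEigenvalue, Submodule.ne_bot_iff]
      exact ⟨x, by simpa [Module.End.mem_genEigenspace_nat] using hk, hx0⟩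
    have hk' : (M - μ • 1) ^ k *ᵥ x = 0 := by
      have : Matrix.toLin' ((M - μ • 1) ^ k) x = 0 := by
        rw [Matrix.toLin'_pow, map_sub, map_smul, Matrix.toLin'_one]; exact hk
      rwa [Matrix.toLin'_apply] at this
    simp only [Matrix.exp_smul_mulVec_eq_sum hk']
    rw [← Finset.sum_const_zero (s := Finset.range k)]
    refine tendsto_finsetSum _ fun j _ => ?_
    simpa only [zero_smul] using (Complex.tendsto_exp_mul_mul_pow (hM μ hμ) j).smul_const
      ((j.factorial : ℂ)⁻¹ • ((M - μ • 1) ^ j *ᵥ x))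

/-- The exponential flow of a stable matrix decays to zero. -/
lemma IsStableMatrix.tendsto_exp {M : Matrix (Fin d) (Fin d) ℝ} (hM : IsStableMatrix M) :
    Tendsto (fun t : ℝ => exp (t • M)) atTop (𝓝 0) := by
  refine tendsto_pi_nhds.2 fun i => tendsto_pi_nhds.2 fun j => ?_
  have h := (tendsto_pi_nhds.1 (Matrix.tendsto_exp_smul_mulVec hM (Pi.single j 1))) i
  have hre := (Complex.continuous_re.tendsto _).comp h
  simp only [Pi.zero_apply, Complex.zero_re] at hre
  refine hre.congr fun t => ?_
  have hmap : exp ((t : ℂ) • M.map (algebraMap ℝ ℂ)) = (exp (t • M)).map (algebraMap ℝ ℂ) := by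
    have h := NormedSpace.map_exp ((algebraMap ℝ ℂ).mapMatrix (m := Fin d))
      (continuous_id.matrix_map Complex.continuous_ofReal) (t • M)
    rw [RingHom.mapMatrix_apply, RingHom.mapMatrix_apply] at h
    refine Eq.trans (congrArg _ ?_) h.symm
    ext a b; simp
  rw [Function.comp_apply, hmap]
  simp

lemma IsStableMatrix.transpose {M : Matrix (Fin d) (Fin d) ℝ} (hM : IsStableMatrix M) :
    IsStableMatrix Mᵀ := by
  intro μ hμ
  refine hM μ ?_
  rw [Module.End.hasEigenvalue_iff_mem_spectrum, Matrix.spectrum_toLin'] at hμ ⊢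
  rw [spectrum.mem_iff, Matrix.isUnit_iff_isUnit_det] at hμ ⊢
  rwa [← Matrix.det_transpose, transpose_sub, Algebra.algebraMap_eq_smul_one, transpose_smul,
    transpose_one, ← Matrix.transpose_map, ← Algebra.algebraMap_eq_smul_one]

/-- Stability, tested on the real and imaginary parts of an eigenvector. -/
lemma isStableMatrix_iff {M : Matrix (Fin d) (Fin d) ℝ} :
    IsStableMatrix M ↔ ∀ (α β : ℝ) (u w : Fin d → ℝ), 0 ≤ α → M *ᵥ u = α • u - β • w →
      M *ᵥ w = β • u + α • w → u = 0 ∧ w = 0 := by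
  have key : ∀ x : Fin d → ℂ, ∀ i, ((M.map (algebraMap ℝ ℂ)) *ᵥ x) i
      = ((M *ᵥ fun i => (x i).re) i : ℂ) + ((M *ᵥ fun i => (x i).im) i : ℂ) * Complex.I := by
    intro x i
    simp only [mulVec, dotProduct, map_apply, Complex.coe_algebraMap, Complex.ofReal_sum,
      Finset.sum_mul, ← Finset.sum_add_distrib]
    refine Finset.sum_congr rfl fun j _ => ?_
    apply Complex.ext <;> simp
  constructor
  · intro h α β u w hα hu hw
    by_contra hne
    have hev : Module.End.HasEigenvalue (Matrix.toLin' (M.map (algebraMap ℝ ℂ))) ⟨α, β⟩ := by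
      refine Module.End.hasEigenvalue_of_hasEigenvector (x := fun i => (⟨u i, w i⟩ : ℂ)) ?_
      rw [Module.End.hasEigenvector_iff, Module.End.mem_eigenspace_iff]
      constructor
      · ext i
        rw [toLin'_apply, key]
        simp only [hu, hw]
        apply Complex.ext <;> simp; ring
      · intro h0
        refine hne ⟨funext fun i => ?_, funext fun i => ?_⟩
        · exact congrArg Complex.re (congrFun h0 i)
        · exact congrArg Complex.im (congrFun h0 i)
    exact absurd (h _ hev) (not_lt.2 hα)
  · intro h μ hμ
    by_contra hre
    obtain ⟨x, hx⟩ := hμ.exists_hasEigenvector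
    have hx' : ∀ i, _ := fun i => congrFun hx.apply_eq_smul i
    simp only [toLin'_apply, key] at hx'
    obtain ⟨h1, h2⟩ := h μ.re μ.im (fun i => (x i).re) (fun i => (x i).im) (not_lt.1 hre)
      (funext fun i => by simpa using congrArg Complex.re (hx' i))
      (funext fun i => by simpa [add_comm] using congrArg Complex.im (hx' i))
    refine hx.2 (funext fun i => Complex.ext ?_ ?_)
    · exact congrFun h1 i
    · exact congrFun h2 i

end

/-! ### Sylvester and Lyapunov equations with stable coefficients. -/

section
open scoped Matrix.Norms.Operator

variable {d s p : ℕ}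

/-- The flow `t ↦ exp (t M)` of the linear system with matrix `M`. -/
noncomputable def Matrix.expFlow (M : Matrix (Fin d) (Fin d) ℝ) (t : ℝ) :
    Matrix (Fin d) (Fin d) ℝ :=
  NormedSpace.exp (t • M)

lemma Matrix.expFlow_zero (M : Matrix (Fin d) (Fin d) ℝ) : expFlow M 0 = 1 := by
  simp [expFlow]

lemma Matrix.hasDerivAt_expFlow (M : Matrix (Fin d) (Fin d) ℝ) (t : ℝ) :
    HasDerivAt (expFlow M) (expFlow M t * M) t :=
  hasDerivAt_exp_smul_const M t

lemma Matrix.commute_expFlow (M : Matrix (Fin d) (Fin d) ℝ) (t : ℝ) : Commute M (expFlow M t) :=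
  ((Commute.refl M).smul_right t).exp_right

lemma Matrix.expFlow_transpose (M : Matrix (Fin d) (Fin d) ℝ) (t : ℝ) :
    expFlow Mᵀ t = (expFlow M t)ᵀ := by
  rw [expFlow, expFlow, ← Matrix.exp_transpose, transpose_smul]

lemma Matrix.expFlow_neg_mul_self (M : Matrix (Fin d) (Fin d) ℝ) (t : ℝ) :
    expFlow (-M) t * expFlow M t = 1 := by
  rw [expFlow, expFlow, ← Matrix.exp_add_of_commute _ _
    (((Commute.refl M).neg_left.smul_left t).smul_right t)]
  simp

lemma IsStableMatrix.tendsto_expFlow {M : Matrix (Fin d) (Fin d) ℝ} (hM : IsStableMatrix M) :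
    Tendsto (expFlow M) atTop (𝓝 0) :=
  hM.tendsto_exp

lemma HasDerivAt.dotProduct_mulVec {F : ℝ → Matrix (Fin d) (Fin d) ℝ}
    {F' : Matrix (Fin d) (Fin d) ℝ} {t : ℝ} (h : HasDerivAt F F' t) (v w : Fin d → ℝ) :
    HasDerivAt (fun τ => v ⬝ᵥ F τ *ᵥ w) (v ⬝ᵥ F' *ᵥ w) t := by
  let L : Matrix (Fin d) (Fin d) ℝ →ₗ[ℝ] ℝ :=
    { toFun := fun X => v ⬝ᵥ X *ᵥ w
      map_add' := fun X Y => by rw [add_mulVec, dotProduct_add]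
      map_smul' := fun c X => by rw [smul_mulVec, dotProduct_smul]; rfl }
  exact (LinearMap.toContinuousLinearMap L).hasFDerivAt.comp_hasDerivAt t h

lemma Filter.Tendsto.dotProduct_mulVec {ι : Type*} {l : Filter ι}
    {F : ι → Matrix (Fin d) (Fin d) ℝ} {G : Matrix (Fin d) (Fin d) ℝ}
    (h : Tendsto F l (𝓝 G)) (v w : Fin d → ℝ) :
    Tendsto (fun i => v ⬝ᵥ F i *ᵥ w) l (𝓝 (v ⬝ᵥ G *ᵥ w)) := by
  have hc : Continuous fun X : Matrix (Fin d) (Fin d) ℝ => v ⬝ᵥ X *ᵥ w := by fun_prop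
  exact (hc.tendsto G).comp h

lemma HasDerivAt.matrix_transpose {F : ℝ → Matrix (Fin d) (Fin d) ℝ}
    {F' : Matrix (Fin d) (Fin d) ℝ} {t : ℝ} (h : HasDerivAt F F' t) :
    HasDerivAt (fun τ => (F τ)ᵀ) F'ᵀ t :=
  (LinearMap.toContinuousLinearMap
    (Matrix.transposeLinearEquiv (Fin d) (Fin d) ℝ ℝ).toLinearMap).hasFDerivAt.comp_hasDerivAt t h

lemma Matrix.hasDerivAt_expFlow_mul_mul (A X B : Matrix (Fin d) (Fin d) ℝ) (t : ℝ) :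
    HasDerivAt (fun τ => expFlow A τ * X * expFlow B τ)
      (expFlow A t * (A * X + X * B) * expFlow B t) t := by
  convert! ((hasDerivAt_expFlow A t).mul_const X).mul (hasDerivAt_expFlow B t) using 1
  rw [← (commute_expFlow B t).eq]
  noncomm_ring

/-- The homogeneous Sylvester equation with stable coefficients has only the zero solution. -/
lemma IsStableMatrix.eq_zero_of_mul_add_mul_eq_zero {A B X : Matrix (Fin d) (Fin d) ℝ}
    (hA : IsStableMatrix A) (hB : IsStableMatrix B) (h : A * X + X * B = 0) : X = 0 := by
  have hder := fun t => hasDerivAt_expFlow_mul_mul A X B t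
  simp only [h, mul_zero, zero_mul] at hder
  have hconst : ∀ t, expFlow A t * X * expFlow B t = X := fun t => by
    have := is_const_of_deriv_eq_zero (fun t => (hder t).differentiableAt)
      (fun t => (hder t).deriv) t 0
    simpa [expFlow_zero] using this
  have hlim : Tendsto (fun t => expFlow A t * X * expFlow B t) atTop (𝓝 (0 * X * 0)) :=
    (hA.tendsto_expFlow.mul_const X).mul hB.tendsto_expFlow
  simp only [hconst, mul_zero] at hlim
  exact tendsto_nhds_unique tendsto_const_nhds hlim

lemma IsStableMatrix.exists_mul_add_mul_eq {A B : Matrix (Fin d) (Fin d) ℝ}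
    (hA : IsStableMatrix A) (hB : IsStableMatrix B) (R : Matrix (Fin d) (Fin d) ℝ) :
    ∃ X, A * X + X * B = R := by
  have hinj : Function.Injective (LinearMap.mulLeft ℝ A + LinearMap.mulRight ℝ B) := by
    rw [← LinearMap.ker_eq_bot, LinearMap.ker_eq_bot']
    exact fun X hX => hA.eq_zero_of_mul_add_mul_eq_zero hB hX
  exact (LinearMap.injective_iff_surjective.1 hinj) R

lemma Matrix.posSemidef_iff_real {M : Matrix (Fin d) (Fin d) ℝ} :
    M.PosSemidef ↔ Mᵀ = M ∧ ∀ x, 0 ≤ x ⬝ᵥ M *ᵥ x := by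
  rw [posSemidef_iff_dotProduct_mulVec, IsHermitian, conjTranspose_eq_transpose_of_trivial]
  simp

lemma Matrix.PosSemidef.dotProduct_nonneg {M : Matrix (Fin d) (Fin d) ℝ} (hM : M.PosSemidef)
    (x : Fin d → ℝ) : 0 ≤ x ⬝ᵥ M *ᵥ x :=
  (posSemidef_iff_real.1 hM).2 x

lemma Matrix.PosSemidef.transpose_eq {M : Matrix (Fin d) (Fin d) ℝ} (hM : M.PosSemidef) :
    Mᵀ = M :=
  (posSemidef_iff_real.1 hM).1

lemma Matrix.posSemidef_transpose_mul_self (F : Matrix (Fin p) (Fin d) ℝ) :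
    (Fᵀ * F).PosSemidef := by
  simpa using posSemidef_conjTranspose_mul_self F

lemma Matrix.posSemidef_self_mul_transpose (F : Matrix (Fin d) (Fin p) ℝ) :
    (F * Fᵀ).PosSemidef := by
  simpa using posSemidef_self_mul_conjTranspose F

lemma Matrix.dotProduct_transpose_mul_self_mulVec (F : Matrix (Fin p) (Fin d) ℝ)
    (x : Fin d → ℝ) : x ⬝ᵥ (Fᵀ * F) *ᵥ x = (F *ᵥ x) ⬝ᵥ (F *ᵥ x) := by
  rw [← mulVec_mulVec, dotProduct_mulVec, vecMul_transpose]

/-- The Lyapunov equation of a stable matrix with semidefinite data has semidefinite solution. -/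
lemma IsStableMatrix.posSemidef_of_lyapunov {M P R : Matrix (Fin d) (Fin d) ℝ}
    (hM : IsStableMatrix M) (hR : R.PosSemidef) (h : Mᵀ * P + P * M = -R) : P.PosSemidef := by
  rw [posSemidef_iff_real]
  constructor
  · have hT : Mᵀ * Pᵀ + Pᵀ * M = -R := by
      have := congrArg Matrix.transpose h
      simp only [transpose_add, transpose_mul, transpose_transpose, transpose_neg,
        hR.transpose_eq] at this
      rw [← this, add_comm]
    refine sub_eq_zero.1 (hM.transpose.eq_zero_of_mul_add_mul_eq_zero hM ?_)
    rw [mul_sub, sub_mul, ← sub_eq_zero.2 (hT.trans h.symm)]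
    abel
  · intro x
    have hder := fun t => (hasDerivAt_expFlow_mul_mul Mᵀ P M t).dotProduct_mulVec x x
    -- Along the flow of M the quadratic form of P decreases to zero, so its initial value is
    -- nonnegative.
    have hanti : Antitone fun t => x ⬝ᵥ (expFlow Mᵀ t * P * expFlow M t) *ᵥ x := by
      refine antitone_of_deriv_nonpos (fun t => (hder t).differentiableAt) fun t => ?_
      rw [(hder t).deriv, h, expFlow_transpose, ← mulVec_mulVec, ← mulVec_mulVec, dotProduct_mulVec,
        vecMul_transpose, neg_mulVec, dotProduct_neg]
      exact neg_nonpos.2 (hR.dotProduct_nonneg _)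
    have hlim : Tendsto (fun t => x ⬝ᵥ (expFlow Mᵀ t * P * expFlow M t) *ᵥ x) atTop (𝓝 0) := by
      have := ((hM.transpose.tendsto_expFlow.mul_const P).mul hM.tendsto_expFlow).dotProduct_mulVec x x
      simpa using this
    simpa [expFlow_zero] using hanti.le_of_tendsto hlim 0

/-- A Lyapunov inequality for `M` transfers stability from `N` to `M`, provided that `M` and `N`
agree where the dissipation vanishes. -/
lemma IsStableMatrix.of_lyapunov {M N P R : Matrix (Fin d) (Fin d) ℝ} (hN : IsStableMatrix N)
    (hP : P.PosSemidef) (hR : R.PosSemidef) (h : Mᵀ * P + P * M = -R)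
    (hMN : ∀ x, x ⬝ᵥ R *ᵥ x = 0 → M *ᵥ x = N *ᵥ x) : IsStableMatrix M := by
  rw [isStableMatrix_iff] at hN ⊢
  intro α β u w hα hu hw
  have hq : ∀ x, 2 * ((M *ᵥ x) ⬝ᵥ P *ᵥ x) = -(x ⬝ᵥ R *ᵥ x) := fun x => by
    have h1 : x ⬝ᵥ (Mᵀ * P + P * M) *ᵥ x = -(x ⬝ᵥ R *ᵥ x) := by
      rw [h, neg_mulVec, dotProduct_neg]
    rw [← h1, add_mulVec, dotProduct_add, ← mulVec_mulVec, ← mulVec_mulVec, dotProduct_mulVec x Mᵀ,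
      vecMul_transpose, dotProduct_mulVec x P, ← mulVec_transpose, hP.transpose_eq,
      dotProduct_comm (P *ᵥ x)]
    ring
  have hsymm : w ⬝ᵥ P *ᵥ u = u ⬝ᵥ P *ᵥ w := by
    rw [dotProduct_mulVec, ← mulVec_transpose, hP.transpose_eq, dotProduct_comm]
  have h1 := hq u
  have h2 := hq w
  rw [hu, sub_dotProduct, smul_dotProduct, smul_dotProduct, smul_eq_mul, smul_eq_mul] at h1
  rw [hw, add_dotProduct, smul_dotProduct, smul_dotProduct, smul_eq_mul, smul_eq_mul] at h2
  -- The β-terms cancel by symmetry of P, so R vanishes on u and w. There M agrees with N, and (u,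
  -- w) becomes an eigenpair of N with α ≥ 0.
  have hsum : u ⬝ᵥ R *ᵥ u + w ⬝ᵥ R *ᵥ w ≤ 0 := by
    have := mul_nonneg hα (hP.dotProduct_nonneg u)
    have := mul_nonneg hα (hP.dotProduct_nonneg w)
    rw [hsymm] at h1
    linarith
  have hRu := hR.dotProduct_nonneg u
  have hRw := hR.dotProduct_nonneg w
  refine hN α β u w hα ?_ ?_
  · rw [← hMN u (by linarith), hu]
  · rw [← hMN w (by linarith), hw]

end

/-! ### The algebraic Riccati equation. -/

section
open scoped Matrix.Norms.Operator

variable {d s p : ℕ}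

lemma Matrix.mulVec_eq_zero_of_dotProduct_transpose_mul_self {F : Matrix (Fin p) (Fin d) ℝ}
    {x : Fin d → ℝ} (h : x ⬝ᵥ (Fᵀ * F) *ᵥ x = 0) : F *ᵥ x = 0 := by
  rwa [dotProduct_transpose_mul_self_mulVec, dotProduct_self_eq_zero] at h

/-- Completing the square in the gain: the last term measures how far an arbitrary K is from the
optimal gain Bᵀ P. -/
lemma riccatiOperator_eq_closedLoop (T P : Matrix (Fin d) (Fin d) ℝ) (B : Matrix (Fin d) (Fin s) ℝ)
    (C : Matrix (Fin p) (Fin d) ℝ) (K : Matrix (Fin s) (Fin d) ℝ) (hP : Pᵀ = P) :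
    riccatiOperator T B C P = (T - B * K)ᵀ * P + P * (T - B * K) + (Cᵀ * C + Kᵀ * K)
      - (K - Bᵀ * P)ᵀ * (K - Bᵀ * P) := by
  simp only [riccatiOperator, transpose_sub, transpose_mul, transpose_transpose, hP,
    Matrix.sub_mul, Matrix.mul_sub, ← Matrix.mul_assoc]
  abel

lemma riccatiOperator_eq_lyapunov (T P : Matrix (Fin d) (Fin d) ℝ) (B : Matrix (Fin d) (Fin s) ℝ)
    (C : Matrix (Fin p) (Fin d) ℝ) (hP : Pᵀ = P) :
    riccatiOperator T B C P = (T - B * Bᵀ * P)ᵀ * P + P * (T - B * Bᵀ * P)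
      + (Cᵀ * C + (Bᵀ * P)ᵀ * (Bᵀ * P)) := by
  have h := riccatiOperator_eq_closedLoop T P B C (Bᵀ * P) hP
  rwa [sub_self, Matrix.mul_zero, sub_zero, ← Matrix.mul_assoc B] at h

/-- One step of the Newton–Kleinman iteration. -/
lemma IsStableMatrix.exists_kleinman_step {T : Matrix (Fin d) (Fin d) ℝ}
    {B : Matrix (Fin d) (Fin s) ℝ} (C : Matrix (Fin p) (Fin d) ℝ) {K : Matrix (Fin s) (Fin d) ℝ}
    (hK : IsStableMatrix (T - B * K)) :
    ∃ P : Matrix (Fin d) (Fin d) ℝ, P.PosSemidef ∧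
      (T - B * K)ᵀ * P + P * (T - B * K) = -(Cᵀ * C + Kᵀ * K) ∧
      IsStableMatrix (T - B * Bᵀ * P) ∧ (-riccatiOperator T B C P).PosSemidef := by
  obtain ⟨P, hlyap⟩ := hK.transpose.exists_mul_add_mul_eq hK (-(Cᵀ * C + Kᵀ * K))
  have hP := hK.posSemidef_of_lyapunov
    ((posSemidef_transpose_mul_self C).add (posSemidef_transpose_mul_self K)) hlyap
  have hric : riccatiOperator T B C P = -((K - Bᵀ * P)ᵀ * (K - Bᵀ * P)) := by
    rw [riccatiOperator_eq_closedLoop T P B C K hP.transpose_eq, hlyap]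
    abel
  refine ⟨P, hP, hlyap, hK.of_lyapunov hP
    (((posSemidef_transpose_mul_self C).add (posSemidef_transpose_mul_self (Bᵀ * P))).add
      (posSemidef_transpose_mul_self (K - Bᵀ * P))) ?_ fun x hx => ?_, ?_⟩
  · rw [riccatiOperator_eq_lyapunov T P B C hP.transpose_eq] at hric
    rw [← sub_eq_zero] at hric ⊢
    rw [← hric]
    abel
  · rw [add_mulVec, dotProduct_add, add_mulVec, dotProduct_add] at hx
    have h1 := (posSemidef_transpose_mul_self C).dotProduct_nonneg x
    have h2 := (posSemidef_transpose_mul_self (Bᵀ * P)).dotProduct_nonneg x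
    have h3 := (posSemidef_transpose_mul_self (K - Bᵀ * P)).dotProduct_nonneg x
    -- Where the dissipation vanishes, the old and the new gain coincide, so the two closed loops
    -- agree.
    have h4 := mulVec_eq_zero_of_dotProduct_transpose_mul_self (F := K - Bᵀ * P) (x := x)
      (by linarith)
    rw [sub_mulVec, sub_eq_zero] at h4
    rw [sub_mulVec, sub_mulVec, Matrix.mul_assoc, ← mulVec_mulVec, ← h4, mulVec_mulVec]
  · rw [hric, neg_neg]
    exact posSemidef_transpose_mul_self _

lemma Matrix.PosSemidef.of_tendsto {P : ℕ → Matrix (Fin d) (Fin d) ℝ}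
    {L : Matrix (Fin d) (Fin d) ℝ} (hP : ∀ n, (P n).PosSemidef) (h : Tendsto P atTop (𝓝 L)) :
    L.PosSemidef := by
  rw [posSemidef_iff_real]
  constructor
  · have hT : Tendsto (fun n => (P n)ᵀ) atTop (𝓝 Lᵀ) :=
      (continuous_id.matrix_transpose.tendsto L).comp h
    simp only [fun n => (hP n).transpose_eq] at hT
    exact tendsto_nhds_unique hT h
  · exact fun x => ge_of_tendsto' (h.dotProduct_mulVec x x) fun n => (hP n).dotProduct_nonneg x

/-- A Loewner-decreasing sequence of positive semidefinite matrices converges. -/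
lemma Matrix.exists_tendsto_of_posSemidef_sub {P : ℕ → Matrix (Fin d) (Fin d) ℝ}
    (hP : ∀ n, (P n).PosSemidef) (hanti : ∀ n, (P n - P (n + 1)).PosSemidef) :
    ∃ L, L.PosSemidef ∧ Tendsto P atTop (𝓝 L) := by
  have hq : ∀ x : Fin d → ℝ, ∃ l, Tendsto (fun n => x ⬝ᵥ P n *ᵥ x) atTop (𝓝 l) := by
    intro x
    refine ⟨_, tendsto_atTop_ciInf (antitone_nat_of_succ_le fun n => ?_) ⟨0, ?_⟩⟩
    · have := (hanti n).dotProduct_nonneg x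
      rw [sub_mulVec, dotProduct_sub] at this
      linarith
    · rintro _ ⟨n, rfl⟩
      exact (hP n).dotProduct_nonneg x
  choose l hl using hq
  -- Polarization recovers the entries from the quadratic form.
  have hentry : ∀ i j, Tendsto (fun n => P n i j) atTop
      (𝓝 ((l (Pi.single i 1 + Pi.single j 1) - l (Pi.single i 1) - l (Pi.single j 1)) / 2)) := by
    intro i j
    refine ((((hl _).sub (hl _)).sub (hl _)).div_const 2).congr fun n => ?_
    have hsymm : P n j i = P n i j := congrFun (congrFun (hP n).transpose_eq i) j
    simp only [mulVec_add, dotProduct_add, add_dotProduct, single_one_dotProduct,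
      mulVec_single_one, col_apply, hsymm]
    ring
  have h : Tendsto P atTop (𝓝 (Matrix.of fun i j =>
      (l (Pi.single i 1 + Pi.single j 1) - l (Pi.single i 1) - l (Pi.single j 1)) / 2)) :=
    tendsto_pi_nhds.2 fun i => tendsto_pi_nhds.2 fun j => hentry i j
  exact ⟨_, PosSemidef.of_tendsto hP h, h⟩

/-- A stabilizable pair admits a positive semidefinite solution of the Riccati equation. -/
lemma IsStabilizable.exists_posSemidef_isARESolution {T : Matrix (Fin d) (Fin d) ℝ}
    {B : Matrix (Fin d) (Fin s) ℝ} (h : IsStabilizable T B) (C : Matrix (Fin p) (Fin d) ℝ) :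
    ∃ P : Matrix (Fin d) (Fin d) ℝ, P.PosSemidef ∧ IsARESolution T B C P := by
  obtain ⟨K, hK⟩ := h
  obtain ⟨P₀, hP₀, -, hstab₀, hric₀⟩ := hK.exists_kleinman_step C
  -- The iterates carry stability, which makes the next step possible, and a negative semidefinite
  -- Riccati residual, which makes that step decreasing.
  let S := {P : Matrix (Fin d) (Fin d) ℝ // P.PosSemidef ∧ IsStableMatrix (T - B * Bᵀ * P) ∧
    (-riccatiOperator T B C P).PosSemidef}
  have hstep : ∀ P : S, ∃ P' : S, (P.1 - P'.1).PosSemidef ∧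
      (T - B * Bᵀ * P.1)ᵀ * P'.1 + P'.1 * (T - B * Bᵀ * P.1)
        + (Cᵀ * C + (Bᵀ * P.1)ᵀ * (Bᵀ * P.1)) = 0 := by
    rintro ⟨P, hP, hstab, hric⟩
    have hstab' := hstab
    rw [Matrix.mul_assoc] at hstab'
    obtain ⟨P', hP', hlyap, hs', hr'⟩ := hstab'.exists_kleinman_step C
    rw [← Matrix.mul_assoc] at hlyap
    -- The decrement P - P' solves the Lyapunov equation of the current closed loop with the Riccati
    -- residual of P as right-hand side.
    refine ⟨⟨P', hP', hs', hr'⟩, hstab.posSemidef_of_lyapunov hric ?_, ?_⟩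
    · change (T - B * Bᵀ * P)ᵀ * (P - P') + (P - P') * (T - B * Bᵀ * P) = _
      rw [neg_neg, riccatiOperator_eq_lyapunov T P B C hP.transpose_eq, mul_sub, sub_mul,
        ← neg_eq_iff_eq_neg.2 hlyap]
      abel
    · exact add_eq_zero_iff_eq_neg.2 hlyap
  choose f hf using hstep
  let P : ℕ → S := fun n => f^[n] ⟨P₀, hP₀, hstab₀, hric₀⟩
  have hsucc : ∀ n, P (n + 1) = f (P n) := fun n => Function.iterate_succ_apply' f n _
  obtain ⟨L, hL, hlim⟩ := exists_tendsto_of_posSemidef_sub (P := fun n => (P n).1)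
    (fun n => (P n).2.1) (fun n => by rw [hsucc]; exact (hf (P n)).1)
  refine ⟨L, hL, ?_⟩
  have hlim' : Tendsto (fun n => (f (P n)).1) atTop (𝓝 L) := by
    simpa only [← hsucc] using (tendsto_add_atTop_iff_nat 1).2 hlim
  have hcont : Continuous fun X : Matrix (Fin d) (Fin d) ℝ × Matrix (Fin d) (Fin d) ℝ =>
      (T - B * Bᵀ * X.1)ᵀ * X.2 + X.2 * (T - B * Bᵀ * X.1)
        + (Cᵀ * C + (Bᵀ * X.1)ᵀ * (Bᵀ * X.1)) := by fun_prop
  have h0 := (hcont.tendsto (L, L)).comp (hlim.prodMk_nhds hlim')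
  have h1 : Tendsto (fun _ : ℕ => (0 : Matrix (Fin d) (Fin d) ℝ)) atTop (𝓝 _) :=
    h0.congr fun n => (hf (P n)).2
  rw [IsARESolution, riccatiOperator_eq_lyapunov T L B C hL.transpose_eq]
  exact tendsto_nhds_unique tendsto_const_nhds h1

/-- Under detectability, positive semidefinite solutions of the Riccati equation are
stabilizing. -/
lemma IsDetectable.isStableMatrix_closedLoop {T P : Matrix (Fin d) (Fin d) ℝ}
    {B : Matrix (Fin d) (Fin s) ℝ} {C : Matrix (Fin p) (Fin d) ℝ} (h : IsDetectable C T)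
    (hP : P.PosSemidef) (hare : IsARESolution T B C P) : IsStableMatrix (T - B * Bᵀ * P) := by
  obtain ⟨L, hL⟩ := h
  rw [IsARESolution, riccatiOperator_eq_lyapunov T P B C hP.transpose_eq] at hare
  refine hL.of_lyapunov hP ((posSemidef_transpose_mul_self C).add
    (posSemidef_transpose_mul_self (Bᵀ * P))) (eq_neg_of_add_eq_zero_left hare.symm) fun x hx => ?_
  rw [add_mulVec, dotProduct_add] at hx
  have h1 := (posSemidef_transpose_mul_self C).dotProduct_nonneg x
  have h2 := (posSemidef_transpose_mul_self (Bᵀ * P)).dotProduct_nonneg x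
  have h3 := mulVec_eq_zero_of_dotProduct_transpose_mul_self (F := C) (x := x) (by linarith)
  have h4 := mulVec_eq_zero_of_dotProduct_transpose_mul_self (F := Bᵀ * P) (x := x) (by linarith)
  rw [sub_mulVec, sub_mulVec, Matrix.mul_assoc, ← mulVec_mulVec, ← mulVec_mulVec x L, h3, h4]
  simp

/-- A symmetric stabilizing solution is the only stabilizing solution, symmetric or not. -/
lemma IsStabilizingARESolution.eq_of_transpose_eq {T X Y : Matrix (Fin d) (Fin d) ℝ}
    {B : Matrix (Fin d) (Fin s) ℝ} {C : Matrix (Fin p) (Fin d) ℝ}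
    (hX : IsStabilizingARESolution T B C X) (hY : IsStabilizingARESolution T B C Y)
    (hsymm : Yᵀ = Y) : X = Y := by
  refine sub_eq_zero.1 (hY.2.transpose.eq_zero_of_mul_add_mul_eq_zero hX.2 ?_)
  -- For symmetric Y, the difference of the two residuals is (T - B Bᵀ Y)ᵀ (X - Y) + (X - Y) (T - B
  -- Bᵀ X); X need not be symmetric.
  have h : riccatiOperator T B C X - riccatiOperator T B C Y = 0 := by
    rw [← hX.1, ← hY.1, sub_self]
  rw [← h]
  simp only [riccatiOperator, transpose_sub, transpose_mul, transpose_transpose, hsymm,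
    Matrix.sub_mul, Matrix.mul_sub, ← Matrix.mul_assoc]
  abel

/-- Under observability, positive semidefinite solutions of the Riccati equation are positive
definite. -/
lemma IsObservable.posDef_of_isARESolution {T P : Matrix (Fin d) (Fin d) ℝ}
    {B : Matrix (Fin d) (Fin s) ℝ} {C : Matrix (Fin p) (Fin d) ℝ} (h : IsObservable C T)
    (hP : P.PosSemidef) (hare : IsARESolution T B C P) : P.PosDef := by
  -- The kernel of P is T-invariant and contained in the kernel of C, hence unobservable.
  have hCT : ∀ x, P *ᵥ x = 0 → C *ᵥ x = 0 ∧ P *ᵥ (T *ᵥ x) = 0 := by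
    intro x hx
    have hxP : x ᵥ* P = 0 := by rw [← mulVec_transpose, hP.transpose_eq, hx]
    have h0 : (Tᵀ * P + P * T - P * B * Bᵀ * P + Cᵀ * C) *ᵥ x = 0 := by
      rw [← riccatiOperator, ← show 0 = riccatiOperator T B C P from hare, zero_mulVec]
    simp only [add_mulVec, sub_mulVec, ← mulVec_mulVec, hx, mulVec_zero, zero_add, sub_zero] at h0
    have hC : C *ᵥ x = 0 := by
      refine mulVec_eq_zero_of_dotProduct_transpose_mul_self ?_
      have := congrArg (x ⬝ᵥ ·) h0
      simpa [dotProduct_add, dotProduct_mulVec x P, hxP, ← mulVec_mulVec] using this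
    exact ⟨hC, by simpa [hC] using h0⟩
  have hpow : ∀ (x : Fin d → ℝ), P *ᵥ x = 0 → ∀ k : ℕ, P *ᵥ (T ^ k *ᵥ x) = 0 := by
    intro x hx k
    induction k with
    | zero => simpa
    | succ k ih => rw [pow_succ', ← mulVec_mulVec]; exact (hCT _ ih).2
  have hker : ∀ x, P *ᵥ x = 0 → x = 0 := by
    intro x hx
    have hobs : observabilityMatrix C T *ᵥ x = 0 := by
      ext ⟨k, i⟩
      have := congrFun (hCT _ (hpow x hx k)).1 i
      rwa [mulVec_mulVec] at this
    have hinj : Function.Injective (observabilityMatrix C T).mulVec := by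
      rw [mulVec_injective_iff, linearIndependent_iff_card_eq_finrank_span, Fintype.card_fin,
        Set.finrank, ← Matrix.rank_eq_finrank_span_cols]
      exact h.symm
    exact hinj (hobs.trans (mulVec_zero _).symm)
  refine PosDef.of_dotProduct_mulVec_pos hP.isHermitian fun x hx => ?_
  rw [star_trivial]
  refine lt_of_le_of_ne (hP.dotProduct_nonneg x) fun h0 => hx (hker x ?_)
  have := (hP.dotProduct_mulVec_zero_iff x).1
  rw [star_trivial] at this
  exact this h0.symm

end

/-! ### Monotonicity along the Hamiltonian system. -/

section
open scoped Matrix.Norms.Operator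

variable {d s p q : ℕ}

lemma HasDerivAt.matrix_inv {N : ℝ → Matrix (Fin d) (Fin d) ℝ} {N' : Matrix (Fin d) (Fin d) ℝ}
    {t : ℝ} (h : HasDerivAt N N' t) (hu : IsUnit (N t)) :
    HasDerivAt (fun τ => (N τ)⁻¹) (-((N t)⁻¹ * N' * (N t)⁻¹)) t := by
  have hfun : (fun τ => (N τ)⁻¹) = fun τ => Ring.inverse (N τ) :=
    funext fun τ => nonsing_inv_eq_ringInverse _
  rw [hfun, nonsing_inv_eq_ringInverse]
  obtain ⟨u, hu⟩ := hu
  have hinv : HasFDerivAt Ring.inverse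
      (-ContinuousLinearMap.mulLeftRight ℝ (Matrix (Fin d) (Fin d) ℝ) ↑u⁻¹ ↑u⁻¹) (N t) :=
    hu ▸ hasFDerivAt_ringInverse u
  have hd := hinv.comp_hasDerivAt t h
  rw [← hu, Ring.inverse_unit]
  exact hd

lemma Matrix.tendsto_inv {ι : Type*} {l : Filter ι} {N : ι → Matrix (Fin d) (Fin d) ℝ}
    {N₀ : Matrix (Fin d) (Fin d) ℝ} (h : Tendsto N l (𝓝 N₀)) (hu : IsUnit N₀) :
    Tendsto (fun i => (N i)⁻¹) l (𝓝 N₀⁻¹) := by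
  simp only [nonsing_inv_eq_ringInverse]
  obtain ⟨u, rfl⟩ := hu
  exact (NormedRing.inverse_continuousAt u).tendsto.comp h

lemma Matrix.dotProduct_self_nonneg (v : Fin d → ℝ) : 0 ≤ v ⬝ᵥ v :=
  Finset.sum_nonneg fun i _ => mul_self_nonneg (v i)

lemma Matrix.isUnit_of_mulVec_eq_zero {N : Matrix (Fin d) (Fin d) ℝ}
    (h : ∀ v, N *ᵥ v = 0 → v = 0) : IsUnit N := by
  rw [isUnit_iff_isUnit_det, isUnit_iff_ne_zero]
  intro h0
  obtain ⟨v, hv, hNv⟩ := exists_mulVec_eq_zero_iff.2 h0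
  exact hv (h v hNv)

/-- The T-terms of the two equations cancel, leaving the sum of squares of control and output. -/
lemma hasDerivAt_hamiltonian {T : Matrix (Fin d) (Fin d) ℝ}
    {B : Matrix (Fin d) (Fin s) ℝ} {C : Matrix (Fin p) (Fin d) ℝ}
    {Ξ Υ : ℝ → Matrix (Fin d) (Fin d) ℝ} {t : ℝ}
    (hΞ : HasDerivAt Ξ (-(T * Ξ t) + B * Bᵀ * Υ t) t)
    (hΥ : HasDerivAt Υ (Tᵀ * Υ t + Cᵀ * C * Ξ t) t) (v : Fin d → ℝ) :
    HasDerivAt (fun τ => v ⬝ᵥ ((Ξ τ)ᵀ * Υ τ) *ᵥ v)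
      ((Bᵀ * Υ t) *ᵥ v ⬝ᵥ (Bᵀ * Υ t) *ᵥ v + (C * Ξ t) *ᵥ v ⬝ᵥ (C * Ξ t) *ᵥ v) t := by
  convert! (hΞ.matrix_transpose.mul hΥ).dotProduct_mulVec v v using 1
  rw [← dotProduct_transpose_mul_self_mulVec, ← dotProduct_transpose_mul_self_mulVec,
    ← dotProduct_add, ← add_mulVec]
  congr 2
  simp only [transpose_add, transpose_neg, transpose_mul, transpose_transpose, Matrix.add_mul,
    Matrix.mul_add, Matrix.neg_mul, ← Matrix.mul_assoc]
  abel

/-- Along solutions `(Ξ, Υ)` of the Hamiltonian system of the Riccati equation, `Ξᵀ Υ` is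
nondecreasing in the Loewner order. -/
lemma monotone_hamiltonian {T : Matrix (Fin d) (Fin d) ℝ}
    {B : Matrix (Fin d) (Fin s) ℝ} {C : Matrix (Fin p) (Fin d) ℝ}
    {Ξ Υ : ℝ → Matrix (Fin d) (Fin d) ℝ}
    (hΞ : ∀ t, HasDerivAt Ξ (-(T * Ξ t) + B * Bᵀ * Υ t) t)
    (hΥ : ∀ t, HasDerivAt Υ (Tᵀ * Υ t + Cᵀ * C * Ξ t) t) (v : Fin d → ℝ) :
    Monotone fun τ => v ⬝ᵥ ((Ξ τ)ᵀ * Υ τ) *ᵥ v := by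
  have hφ := fun t => hasDerivAt_hamiltonian (hΞ t) (hΥ t) v
  refine monotone_of_deriv_nonneg (fun t => (hφ t).differentiableAt) fun t => ?_
  rw [(hφ t).deriv]
  exact add_nonneg (dotProduct_self_nonneg _) (dotProduct_self_nonneg _)

/-- If the quadratic form `Ξᵀ Υ` at `v` does not increase on `[0, b]`, the control and the output
vanish there, and `Ξ` evolves under the output-injected flow. -/
lemma expFlow_mulVec_eq_of_hamiltonian {T : Matrix (Fin d) (Fin d) ℝ}
    {B : Matrix (Fin d) (Fin s) ℝ} {C : Matrix (Fin p) (Fin d) ℝ}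
    {Ξ Υ : ℝ → Matrix (Fin d) (Fin d) ℝ}
    (hΞ : ∀ t, HasDerivAt Ξ (-(T * Ξ t) + B * Bᵀ * Υ t) t)
    (hΥ : ∀ t, HasDerivAt Υ (Tᵀ * Υ t + Cᵀ * C * Ξ t) t) (L : Matrix (Fin d) (Fin p) ℝ)
    {v : Fin d → ℝ} {b : ℝ} (hb : 0 ≤ b) (h0 : 0 ≤ v ⬝ᵥ ((Ξ 0)ᵀ * Υ 0) *ᵥ v)
    (h1 : v ⬝ᵥ ((Ξ b)ᵀ * Υ b) *ᵥ v ≤ 0) :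
    expFlow (T - L * C) b *ᵥ (Ξ b *ᵥ v) = Ξ 0 *ᵥ v := by
  rcases hb.eq_or_lt with rfl | hb
  · simp [expFlow_zero]
  have hφ := fun t => hasDerivAt_hamiltonian (hΞ t) (hΥ t) v
  set φ := fun τ => v ⬝ᵥ ((Ξ τ)ᵀ * Υ τ) *ᵥ v with hφ_def
  have hmono : Monotone φ := monotone_hamiltonian hΞ hΥ v
  have hzero : ∀ t ∈ Set.Ioo 0 b, (Bᵀ * Υ t) *ᵥ v = 0 ∧ (C * Ξ t) *ᵥ v = 0 := by
    intro t ht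
    -- The monotone φ starts nonnegative and ends nonpositive, so it is zero in between and both
    -- squares in its derivative vanish.
    have hloc : φ =ᶠ[𝓝 t] fun _ => 0 := by
      filter_upwards [Ioo_mem_nhds ht.1 ht.2] with τ hτ
      exact le_antisymm ((hmono hτ.2.le).trans h1) (h0.trans (hmono hτ.1.le))
    have hd := (hφ t).unique ((hasDerivAt_const t (0 : ℝ)).congr_of_eventuallyEq hloc)
    have hn1 := dotProduct_self_nonneg ((Bᵀ * Υ t) *ᵥ v)
    have hn2 := dotProduct_self_nonneg ((C * Ξ t) *ᵥ v)
    exact ⟨dotProduct_self_eq_zero.1 (by linarith), dotProduct_self_eq_zero.1 (by linarith)⟩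
  have hF := fun t => (hasDerivAt_expFlow (T - L * C) t).mul (hΞ t)
  ext i
  have hψ := fun t => (hF t).dotProduct_mulVec (Pi.single i 1) v
  -- The mean value theorem needs the derivative only in the open interval, where control and output
  -- vanish; the injection L C is then free to be inserted.
  obtain ⟨c, hc, hslope⟩ := exists_hasDerivAt_eq_slope _ _ hb
    (fun t _ => (hψ t).continuousAt.continuousWithinAt) fun t _ => hψ t
  have hder : (expFlow (T - L * C) c * (T - L * C) * Ξ c +
      expFlow (T - L * C) c * (-(T * Ξ c) + B * Bᵀ * Υ c)) *ᵥ v = 0 := by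
    have : expFlow (T - L * C) c * (T - L * C) * Ξ c +
        expFlow (T - L * C) c * (-(T * Ξ c) + B * Bᵀ * Υ c) =
        expFlow (T - L * C) c * (B * (Bᵀ * Υ c) - L * (C * Ξ c)) := by
      simp only [Matrix.mul_add, Matrix.mul_sub, Matrix.sub_mul, Matrix.mul_neg,
        ← Matrix.mul_assoc]
      abel
    rw [this, ← mulVec_mulVec, sub_mulVec, ← mulVec_mulVec, ← mulVec_mulVec v L, (hzero c hc).1,
      (hzero c hc).2]
    simp
  rw [hder, dotProduct_zero, eq_comm, div_eq_zero_iff, or_iff_left (by linarith), sub_eq_zero]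
    at hslope
  simpa [expFlow_zero, ← mulVec_mulVec] using hslope

/-! ### Explicit Riccati flow around an algebraic solution. -/

section Shifted

variable {T P W D : Matrix (Fin d) (Fin d) ℝ} {B : Matrix (Fin d) (Fin s) ℝ}
  {C : Matrix (Fin p) (Fin d) ℝ}

/-- `1 + W(t) D`, where `W(t)` is the finite-horizon Gramian of `A` with infinite-horizon
Gramian `W`. -/
noncomputable def gramianFactor (A W D : Matrix (Fin d) (Fin d) ℝ) (t : ℝ) :
    Matrix (Fin d) (Fin d) ℝ :=
  1 + (W - expFlow A t * W * expFlow Aᵀ t) * D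

lemma gramianFactor_zero (A W D : Matrix (Fin d) (Fin d) ℝ) : gramianFactor A W D 0 = 1 := by
  simp [gramianFactor, expFlow_zero]

/-- The Lyapunov equation for W turns the derivative of W - exp(tA) W exp(tAᵀ) into the Gramian
integrand. -/
lemma hasDerivAt_gramianFactor {A S : Matrix (Fin d) (Fin d) ℝ} (hW : A * W + W * Aᵀ = -S)
    (t : ℝ) :
    HasDerivAt (gramianFactor A W D) (expFlow A t * S * expFlow Aᵀ t * D) t := by
  have h := (((hasDerivAt_expFlow_mul_mul A W Aᵀ t).const_sub W).mul_const D).const_add 1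
  rw [hW, mul_neg, neg_mul, neg_mul, neg_mul, neg_neg] at h
  exact h

lemma tendsto_gramianFactor {A : Matrix (Fin d) (Fin d) ℝ} (hA : IsStableMatrix A)
    (W D : Matrix (Fin d) (Fin d) ℝ) :
    Tendsto (gramianFactor A W D) atTop (𝓝 (1 + W * D)) := by
  have h := (((hA.tendsto_expFlow.mul_const W).mul hA.transpose.tendsto_expFlow).const_sub
    W).mul_const D |>.const_add 1
  rw [zero_mul, zero_mul, sub_zero] at h
  exact h

/-- The state component of the Hamiltonian system started at `(1, P + D)`. -/
noncomputable def hamiltonianState (A W D : Matrix (Fin d) (Fin d) ℝ) (t : ℝ) :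
    Matrix (Fin d) (Fin d) ℝ :=
  expFlow (-A) t * gramianFactor A W D t

/-- The costate component of the Hamiltonian system started at `(1, P + D)`. -/
noncomputable def hamiltonianCostate (A P W D : Matrix (Fin d) (Fin d) ℝ) (t : ℝ) :
    Matrix (Fin d) (Fin d) ℝ :=
  expFlow Aᵀ t * D + P * hamiltonianState A W D t

lemma hamiltonianState_zero (A W D : Matrix (Fin d) (Fin d) ℝ) : hamiltonianState A W D 0 = 1 := by
  simp [hamiltonianState, expFlow_zero, gramianFactor_zero]

lemma hamiltonianCostate_zero (A P W D : Matrix (Fin d) (Fin d) ℝ) :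
    hamiltonianCostate A P W D 0 = D + P := by
  simp [hamiltonianCostate, expFlow_zero, hamiltonianState_zero]

lemma isARESolution_iff_eq : IsARESolution T B C P ↔
    Cᵀ * C = P * (B * Bᵀ) * P - Tᵀ * P - P * T := by
  rw [IsARESolution, riccatiOperator, ← Matrix.mul_assoc P B, eq_comm, ← sub_eq_zero (a := Cᵀ * C)]
  constructor <;> intro h <;> rw [← h] <;> abel

lemma transpose_closedLoop (hP : Pᵀ = P) : (T - B * Bᵀ * P)ᵀ = Tᵀ - P * (B * Bᵀ) := by
  simp [hP, Matrix.mul_assoc]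

lemma hasDerivAt_hamiltonianState
    (hW : (T - B * Bᵀ * P) * W + W * (T - B * Bᵀ * P)ᵀ = -(B * Bᵀ)) (t : ℝ) :
    HasDerivAt (hamiltonianState (T - B * Bᵀ * P) W D)
      (-(T * hamiltonianState (T - B * Bᵀ * P) W D t) +
        B * Bᵀ * hamiltonianCostate (T - B * Bᵀ * P) P W D t) t := by
  convert! (hasDerivAt_expFlow _ t).mul (hasDerivAt_gramianFactor hW t) using 1
  rw [hamiltonianCostate, hamiltonianState]
  set A := T - B * Bᵀ * P with hA
  have hT : T = A + B * Bᵀ * P := by rw [hA]; abel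
  rw [← (commute_expFlow (-A) t).eq, ← mul_assoc (expFlow (-A) t), ← mul_assoc (expFlow (-A) t),
    ← mul_assoc (expFlow (-A) t), expFlow_neg_mul_self, hT]
  generalize B * Bᵀ = S
  noncomm_ring

lemma hasDerivAt_hamiltonianCostate (hP : Pᵀ = P) (hare : IsARESolution T B C P)
    (hW : (T - B * Bᵀ * P) * W + W * (T - B * Bᵀ * P)ᵀ = -(B * Bᵀ)) (t : ℝ) :
    HasDerivAt (hamiltonianCostate (T - B * Bᵀ * P) P W D)
      (Tᵀ * hamiltonianCostate (T - B * Bᵀ * P) P W D t +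
        Cᵀ * C * hamiltonianState (T - B * Bᵀ * P) W D t) t := by
  convert! ((hasDerivAt_expFlow (T - B * Bᵀ * P)ᵀ t).mul_const D).add
    ((hasDerivAt_hamiltonianState hW t).const_mul P) using 1
  rw [← (commute_expFlow (T - B * Bᵀ * P)ᵀ t).eq, hamiltonianCostate, isARESolution_iff_eq.1 hare]
  generalize expFlow (T - B * Bᵀ * P)ᵀ t = E
  rw [transpose_closedLoop hP]
  generalize hamiltonianState (T - B * Bᵀ * P) W D t = X
  generalize B * Bᵀ = S
  noncomm_ring

/-- If the factor kills v, then Ξ(t) v = 0 and the monotone form, nonnegative at 0, vanishes at t.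
The rigidity of that case carries Ξ(t) v back to v, so v = 0; no injection is needed, hence L = 0.
-/
lemma isUnit_gramianFactor (hP : Pᵀ = P) (hare : IsARESolution T B C P)
    (hW : (T - B * Bᵀ * P) * W + W * (T - B * Bᵀ * P)ᵀ = -(B * Bᵀ))
    (hD : (D + P).PosSemidef) {t : ℝ} (ht : 0 ≤ t) :
    IsUnit (gramianFactor (T - B * Bᵀ * P) W D t) := by
  refine isUnit_of_mulVec_eq_zero fun v hv => ?_
  have hX : hamiltonianState (T - B * Bᵀ * P) W D t *ᵥ v = 0 := by
    rw [hamiltonianState, ← mulVec_mulVec, hv, mulVec_zero]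
  have h := expFlow_mulVec_eq_of_hamiltonian (hasDerivAt_hamiltonianState (D := D) hW)
    (hasDerivAt_hamiltonianCostate hP hare hW) 0 (v := v) ht
    (by simpa [hamiltonianState_zero, hamiltonianCostate_zero] using hD.dotProduct_nonneg v)
    (by rw [← mulVec_mulVec, dotProduct_mulVec, vecMul_transpose, hX, zero_dotProduct])
  rw [hX] at h
  simpa [hamiltonianState_zero] using h.symm

/-- A direction annihilated by the infinite-horizon factor is carried to zero by the Hamiltonian
state. -/
lemma tendsto_hamiltonianState_mulVec {A : Matrix (Fin d) (Fin d) ℝ} (hA : IsStableMatrix A)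
    {v : Fin d → ℝ} (hv : (1 + W * D) *ᵥ v = 0) :
    Tendsto (fun t => hamiltonianState A W D t *ᵥ v) atTop (𝓝 0) := by
  -- The growing factor exp(-tA) meets either (1 + W D) v = 0 or its own inverse exp(tA), so only a
  -- decaying term survives.
  have hX : ∀ t, hamiltonianState A W D t *ᵥ v = -((W * expFlow Aᵀ t * D) *ᵥ v) := fun t => by
    have : hamiltonianState A W D t = expFlow (-A) t * (1 + W * D) -
        expFlow (-A) t * expFlow A t * (W * expFlow Aᵀ t * D) := by
      rw [hamiltonianState, gramianFactor]; noncomm_ring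
    rw [this, expFlow_neg_mul_self, one_mul, sub_mulVec, ← mulVec_mulVec, hv, mulVec_zero,
      zero_sub]
  have hc : Continuous fun X : Matrix (Fin d) (Fin d) ℝ => -((W * X * D) *ᵥ v) := by fun_prop
  have h := (hc.tendsto 0).comp hA.transpose.tendsto_expFlow
  simp only [mul_zero, zero_mul, zero_mulVec, neg_zero] at h
  exact h.congr fun t => (hX t).symm

lemma tendsto_hamiltonianCostate_mulVec {A : Matrix (Fin d) (Fin d) ℝ} (hA : IsStableMatrix A)
    {v : Fin d → ℝ} (hv : (1 + W * D) *ᵥ v = 0) :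
    Tendsto (fun t => hamiltonianCostate A P W D t *ᵥ v) atTop (𝓝 0) := by
  have hc : Continuous fun X : Matrix (Fin d) (Fin d) ℝ × (Fin d → ℝ) =>
    (X.1 * D) *ᵥ v + P *ᵥ X.2 := by fun_prop
  have h := (hc.tendsto (0, 0)).comp
    (hA.transpose.tendsto_expFlow.prodMk_nhds (tendsto_hamiltonianState_mulVec hA hv))
  simp only [zero_mul, zero_mulVec, mulVec_zero, add_zero] at h
  refine h.congr fun t => ?_
  rw [hamiltonianCostate, add_mulVec, ← mulVec_mulVec v P]
  rfl

/-- Infinite-horizon version of the same rigidity. For v in the kernel, state and costate tend to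
zero, so the form is nonpositive at every t. Then v = exp(t(T - L C)) Ξ(t) v, and with L from
detectability both factors tend to zero. -/
lemma IsDetectable.isUnit_one_add_gramian_mul (hdet : IsDetectable C T) (hP : Pᵀ = P)
    (hare : IsARESolution T B C P) (hA : IsStableMatrix (T - B * Bᵀ * P))
    (hW : (T - B * Bᵀ * P) * W + W * (T - B * Bᵀ * P)ᵀ = -(B * Bᵀ))
    (hD : (D + P).PosSemidef) : IsUnit (1 + W * D) := by
  refine isUnit_of_mulVec_eq_zero fun v hv => ?_
  obtain ⟨L, hL⟩ := hdet
  have hΞ := hasDerivAt_hamiltonianState (D := D) hW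
  have hΥ := hasDerivAt_hamiltonianCostate (D := D) hP hare hW
  have hXlim := tendsto_hamiltonianState_mulVec hA hv
  have hYlim := tendsto_hamiltonianCostate_mulVec (P := P) hA hv
  have hΞ0 := hamiltonianState_zero (T - B * Bᵀ * P) W D
  have hΥ0 := hamiltonianCostate_zero (T - B * Bᵀ * P) P W D
  generalize hamiltonianState (T - B * Bᵀ * P) W D = Ξ at *
  generalize hamiltonianCostate (T - B * Bᵀ * P) P W D = Υ at *
  have hφlim : Tendsto (fun t => v ⬝ᵥ ((Ξ t)ᵀ * Υ t) *ᵥ v) atTop (𝓝 0) := by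
    have hc : Continuous fun X : (Fin d → ℝ) × (Fin d → ℝ) => X.1 ⬝ᵥ X.2 := by fun_prop
    have h := (hc.tendsto (0, 0)).comp (hXlim.prodMk_nhds hYlim)
    rw [zero_dotProduct] at h
    refine h.congr fun t => ?_
    rw [← mulVec_mulVec, dotProduct_mulVec v, vecMul_transpose]
    rfl
  have heq : ∀ t, 0 ≤ t → expFlow (T - L * C) t *ᵥ (Ξ t *ᵥ v) = v := fun t ht => by
    have h := expFlow_mulVec_eq_of_hamiltonian hΞ hΥ L (v := v) ht
      (by simpa [hΞ0, hΥ0] using hD.dotProduct_nonneg v)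
      ((monotone_hamiltonian hΞ hΥ v).ge_of_tendsto hφlim t)
    simpa [hΞ0] using h
  have hc : Continuous fun X : Matrix (Fin d) (Fin d) ℝ × (Fin d → ℝ) => X.1 *ᵥ X.2 := by fun_prop
  have hlim := (hc.tendsto (0, 0)).comp (hL.tendsto_expFlow.prodMk_nhds hXlim)
  rw [zero_mulVec] at hlim
  refine tendsto_nhds_unique (tendsto_const_nhds.congr' ?_) hlim
  filter_upwards [eventually_ge_atTop 0] with t ht
  exact (heq t ht).symm

/-- The solution of the differential Riccati equation with initial value `P + D`, in terms of a
solution `P` of the algebraic equation. -/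
noncomputable def riccatiFlow (A P W D : Matrix (Fin d) (Fin d) ℝ) (t : ℝ) :
    Matrix (Fin d) (Fin d) ℝ :=
  P + expFlow Aᵀ t * D * (gramianFactor A W D t)⁻¹ * expFlow A t

/-- The algebraic equation for P removes the constant term; the derivative of the inverse factor
supplies the quadratic one. -/
lemma hasDerivAt_riccatiFlow (hP : Pᵀ = P) (hare : IsARESolution T B C P)
    (hW : (T - B * Bᵀ * P) * W + W * (T - B * Bᵀ * P)ᵀ = -(B * Bᵀ)) {t : ℝ}
    (hN : IsUnit (gramianFactor (T - B * Bᵀ * P) W D t)) :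
    HasDerivAt (riccatiFlow (T - B * Bᵀ * P) P W D)
      (riccatiOperator T B C (riccatiFlow (T - B * Bᵀ * P) P W D t)) t := by
  have hder := ((((hasDerivAt_expFlow (T - B * Bᵀ * P)ᵀ t).mul_const D).mul
    ((hasDerivAt_gramianFactor (D := D) hW t).matrix_inv hN)).mul
      (hasDerivAt_expFlow (T - B * Bᵀ * P) t)).const_add P
  convert! hder using 1
  change _ = _ * expFlow (T - B * Bᵀ * P) t +
    expFlow (T - B * Bᵀ * P)ᵀ t * D * (gramianFactor (T - B * Bᵀ * P) W D t)⁻¹ * _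
  rw [← (commute_expFlow (T - B * Bᵀ * P)ᵀ t).eq, riccatiOperator, riccatiFlow, isARESolution_iff_eq.1 hare]
  simp only [Matrix.mul_assoc _ B]
  generalize expFlow (T - B * Bᵀ * P)ᵀ t = E'
  generalize expFlow (T - B * Bᵀ * P) t = E
  generalize (gramianFactor (T - B * Bᵀ * P) W D t)⁻¹ = N
  rw [transpose_closedLoop hP]
  generalize B * Bᵀ = S
  noncomm_ring

lemma tendsto_riccatiFlow {A : Matrix (Fin d) (Fin d) ℝ} (hA : IsStableMatrix A)
    (hu : IsUnit (1 + W * D)) : Tendsto (riccatiFlow A P W D) atTop (𝓝 P) := by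
  have h := (((hA.transpose.tendsto_expFlow.mul_const D).mul
    (tendsto_inv (tendsto_gramianFactor hA W D) hu)).mul hA.tendsto_expFlow).const_add P
  simp only [zero_mul, mul_zero, add_zero] at h
  exact h

end Shifted

/-! ### Uniqueness, existence and convergence for the differential equation. -/

lemma IsDRESolution.hasDerivWithinAt {T : Matrix (Fin d) (Fin d) ℝ} {B : Matrix (Fin d) (Fin s) ℝ}
    {C : Matrix (Fin p) (Fin d) ℝ} {Z : Matrix (Fin d) (Fin q) ℝ}
    {Y : ℝ → Matrix (Fin d) (Fin d) ℝ} (h : IsDRESolution T B C Z Y) {t : ℝ} (ht : 0 ≤ t) :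
    HasDerivWithinAt Y (riccatiOperator T B C (Y t)) (Set.Ici 0) t :=
  hasDerivWithinAt_pi.2 fun i => hasDerivWithinAt_pi.2 fun j => h.2 t ht i j

lemma contDiff_riccatiOperator (T : Matrix (Fin d) (Fin d) ℝ) (B : Matrix (Fin d) (Fin s) ℝ)
    (C : Matrix (Fin p) (Fin d) ℝ) : ContDiff ℝ 1 (riccatiOperator T B C) := by
  have h : riccatiOperator T B C = fun Y => Tᵀ * Y + Y * T - Y * (B * Bᵀ) * Y + Cᵀ * C := by
    funext Y; rw [riccatiOperator, Matrix.mul_assoc Y B]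
  rw [h]
  fun_prop

lemma IsDRESolution.eqOn {T : Matrix (Fin d) (Fin d) ℝ} {B : Matrix (Fin d) (Fin s) ℝ}
    {C : Matrix (Fin p) (Fin d) ℝ} {Z : Matrix (Fin d) (Fin q) ℝ}
    {Y Y' : ℝ → Matrix (Fin d) (Fin d) ℝ} (h : IsDRESolution T B C Z Y)
    (h' : IsDRESolution T B C Z Y') : Set.EqOn Y' Y (Set.Ici 0) := by
  intro b hb
  have hc : ∀ {Y : ℝ → Matrix (Fin d) (Fin d) ℝ}, IsDRESolution T B C Z Y →
      ContinuousOn Y (Set.Icc 0 b) := fun h t ht =>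
    (h.hasDerivWithinAt ht.1).continuousWithinAt.mono Set.Icc_subset_Ici_self
  have hd : ∀ {Y : ℝ → Matrix (Fin d) (Fin d) ℝ}, IsDRESolution T B C Z Y →
      ∀ t ∈ Set.Ico 0 b, HasDerivWithinAt Y (riccatiOperator T B C (Y t)) (Set.Ici t) t :=
    fun h t ht => (h.hasDerivWithinAt ht.1).mono (Set.Ici_subset_Ici.2 ht.1)
  -- The operator is only locally Lipschitz, but on [0, b] both solutions stay in one compact set,
  -- which yields a uniform constant.
  obtain ⟨K, hK⟩ := ((contDiff_riccatiOperator T B C).locallyLipschitz.locallyLipschitzOn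
    (s := Y' '' Set.Icc 0 b ∪ Y '' Set.Icc 0 b)).exists_lipschitzOnWith_of_compact
    ((isCompact_Icc.image_of_continuousOn (hc h')).union
      (isCompact_Icc.image_of_continuousOn (hc h)))
  exact ODE_solution_unique_of_mem_Icc_right (v := fun _ => riccatiOperator T B C)
    (s := fun _ => Y' '' Set.Icc 0 b ∪ Y '' Set.Icc 0 b) (fun _ _ => hK) (hc h') (hd h')
    (fun t ht => Or.inl ⟨t, Set.Ico_subset_Icc_self ht, rfl⟩) (hc h) (hd h)
    (fun t ht => Or.inr ⟨t, Set.Ico_subset_Icc_self ht, rfl⟩) (h'.1.trans h.1.symm) ⟨hb, le_rfl⟩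

/-- Under stabilizability and detectability, the differential Riccati equation has a solution on
`[0, ∞)` converging to any given positive semidefinite solution of the algebraic equation. -/
lemma IsDetectable.exists_isDRESolution_tendsto {T P : Matrix (Fin d) (Fin d) ℝ}
    {B : Matrix (Fin d) (Fin s) ℝ} {C : Matrix (Fin p) (Fin d) ℝ} (hdet : IsDetectable C T)
    (hP : P.PosSemidef) (hare : IsARESolution T B C P) (Z : Matrix (Fin d) (Fin q) ℝ) :
    ∃ Y, IsDRESolution T B C Z Y ∧ Tendsto Y atTop (𝓝 P) := by
  have hA := hdet.isStableMatrix_closedLoop hP hare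
  obtain ⟨W, hW⟩ := hA.exists_mul_add_mul_eq hA.transpose (-(B * Bᵀ))
  -- Only the initial value P + D has to be semidefinite; the deviation D itself may be indefinite.
  have hD : (Z * Zᵀ - P + P).PosSemidef := by
    rw [sub_add_cancel]; exact posSemidef_self_mul_transpose Z
  refine ⟨riccatiFlow (T - B * Bᵀ * P) P W (Z * Zᵀ - P), ⟨?_, fun t ht i j => ?_⟩,
    tendsto_riccatiFlow hA
      (hdet.isUnit_one_add_gramian_mul hP.transpose_eq hare hA hW hD)⟩
  · simp [riccatiFlow, gramianFactor_zero, expFlow_zero]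
  · exact (hasDerivAt_pi.1 (hasDerivAt_pi.1 (hasDerivAt_riccatiFlow hP.transpose_eq hare hW
      (isUnit_gramianFactor hP.transpose_eq hare hW hD ht)) i) j).hasDerivWithinAt

end

theorem mainTheorem2 {n d s p q : ℕ}
    (A : Matrix (Fin n) (Fin n) ℝ) (B : Matrix (Fin n) (Fin s) ℝ)
    (C : Matrix (Fin p) (Fin n) ℝ) (Z : Matrix (Fin n) (Fin q) ℝ)
    (V : Matrix (Fin n) (Fin d) ℝ) (hV : Vᵀ * V = 1)
    (T : Matrix (Fin d) (Fin d) ℝ) (hT : T = reducedState V A)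
    (Bm : Matrix (Fin d) (Fin s) ℝ) (hBm : Bm = reducedInput V B)
    (Cm : Matrix (Fin p) (Fin d) ℝ) (hCm : Cm = reducedOutput V C)
    (Zm : Matrix (Fin d) (Fin q) ℝ) (hZm : Zm = reducedInput V Z)
    (hstab : IsStabilizable T Bm) (hdet : IsDetectable Cm T) :
    ∃ Y : ℝ → Matrix (Fin d) (Fin d) ℝ,
      IsDRESolution T Bm Cm Zm Y ∧
      (∀ Y' : ℝ → Matrix (Fin d) (Fin d) ℝ,
        IsDRESolution T Bm Cm Zm Y' → Set.EqOn Y' Y (Set.Ici 0)) ∧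
      ∃ Yinf : Matrix (Fin d) (Fin d) ℝ,
        Tendsto Y atTop (𝓝 Yinf) ∧
        (Yinf.PosSemidef ∧ IsARESolution T Bm Cm Yinf ∧
          ∀ X : Matrix (Fin d) (Fin d) ℝ,
            X.PosSemidef → IsARESolution T Bm Cm X → X = Yinf) ∧
        (IsStabilizingARESolution T Bm Cm Yinf ∧
          ∀ X : Matrix (Fin d) (Fin d) ℝ, IsStabilizingARESolution T Bm Cm X → X = Yinf) ∧
        (IsObservable Cm T → Yinf.PosDef) := by
  obtain ⟨P, hP, hare⟩ := hstab.exists_posSemidef_isARESolution Cm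
  obtain ⟨Y, hY, hlim⟩ := hdet.exists_isDRESolution_tendsto hP hare Zm
  have hPstab : IsStabilizingARESolution T Bm Cm P :=
    ⟨hare, hdet.isStableMatrix_closedLoop hP hare⟩
  have huniq : ∀ X, IsStabilizingARESolution T Bm Cm X → X = P := fun X hX =>
    hX.eq_of_transpose_eq hPstab hP.transpose_eq
  exact ⟨Y, hY, fun Y' hY' => hY.eqOn hY', P, hlim,
    ⟨hP, hare, fun X hX hXare => huniq X ⟨hXare, hdet.isStableMatrix_closedLoop hX hXare⟩⟩,
    ⟨hPstab, huniq⟩, fun hobs => hobs.posDef_of_isARESolution hP hare⟩
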